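/- Let $(\Omega,\mathcal F,P)$ be a complete probability space carrying a standard real Brownian motion $W=(W_t)_{t\ge 0}$, let $(\mathcal F_t)$ be its natural filtration augmented to satisfy the usual conditions, and let $\Theta\subset\mathbb R$ be compact and convex. Let $\mathcal A^\Theta$ be the set of $(\mathcal F_t)$-progressively measurable processes $\theta:[0,\infty)\times\Omega\to\Theta$ with $E_P\big[\int_0^T|\theta_s|^2\,ds\big]<\infty$ for all $T>0$, and for $\theta\in\mathcal A^\Theta$ let $B^\theta_t=\int_0^t\theta_s\,dW_s$ (continuous version of the Itô integral, started at $0$). Let $B$ be the coordinate process on the space of continuous paths $w:[0,\infty)\to\mathbb R$ with $w(0)=0$. Fix $T\ge 0$ and a real number $p\ge 1$. Let $\mathcal C_T$ be the vector space of cylinder functions $\xi=\varphi(B_{t_1\wedge T},\dots,B_{t_n\wedge T})$, where $n\in\mathbb N$, $t_1,\dots,t_n\in[0,\infty)$ and $\varphi\in C_{l.Lip}(\mathbb R^n)$, i.e. $|\varphi(x)-\varphi(y)|\le C(1+|x|^m+|y|^m)|x-y|$ for all $x,y$ and some $C\ge0$, $m\in\mathbb N$. For $\xi\in\mathcal C_T$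 as above put $\xi^\theta=\varphi(B^\theta_{t_1\wedge T},\dots,B^\theta_{t_n\wedge T})$. The G-expectation is $\hat E[\xi]=\sup_{\theta\in\mathcal A^\Theta}E_P[\xi^\theta]$, and $L_G^p(\Omega_T)$ denotes the completion of $\mathcal C_T$ under $\|\xi\|_{L_G^p}=\hat E[|\xi|^p]^{1/p}$. Let $\Phi$ be the map from $L_G^p(\Omega_T)$ to families $\{X^\theta\}_{\theta\in\mathcal A^\Theta}$ of random variables on $(\Omega,\mathcal F,P)$ (taken modulo $P$-a.s. equality) that is given by $\Phi(\xi)=\{\xi^\theta\}_{\theta\in\mathcal A^\Theta}$ for $\xi\in\mathcal C_T$ and extended to $L_G^p(\Omega_T)$ by continuity with respect to the norm $\sup_{\theta\in\mathcal A^\Theta}\|X^\theta\|_{L^p(P)}$. Then for every $X\in L_G^p(\Omega_T)$ and every $\lambda\in\mathbb R$, $$\Phi(\lambda X)=\lambda\,\Phi(X),$$ where $\lambda\{X^\theta\}_\theta=\{\lambda X^\theta\}_\theta$. -/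

import Mathlib

open MeasureTheory ProbabilityTheory Filter Topology
open scoped NNReal ENNReal

noncomputable section

universe u

namespace GExpectation

/-- The path space `C₀([0,∞))` of continuous real paths that start at `0`. -/
abbrev PathSpace : Type := {w : C(ℝ≥0, ℝ) // w 0 = 0}

section Controls

variable {Ω : Type u} {mΩ : MeasurableSpace Ω} {P : Measure Ω} [P.IsComplete] {W : ℝ≥0 → Ω → ℝ}

/-- The natural filtration of the Brownian motion `W`, enlarged by all `P`-null sets. -/
def nullFiltration (hW : IsBrownianReal W P) : Filtration ℝ≥0 mΩ where
  seq t := (⨆ s ≤ t, MeasurableSpace.comap (W s) inferInstance) ⊔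
    MeasurableSpace.generateFrom {A : Set Ω | P A = 0}
  mono' _ _ hst := sup_le_sup_right (biSup_mono fun _ h => h.trans hst) _
  le' t := by
    refine sup_le (iSup₂_le fun s _ => ?_) (MeasurableSpace.generateFrom_le fun A hA => ?_)
    · exact ((hW.aemeasurable s).nullMeasurable.measurable_of_complete).comap_le
    · exact Measure.IsComplete.out' A hA

/-- The natural filtration of `W`, augmented to satisfy the usual conditions. -/
def brownianFiltration (hW : IsBrownianReal W P) : Filtration ℝ≥0 mΩ :=
  (nullFiltration hW).rightCont

/-- The admissible controls: progressively measurable `Θ`-valued processes that are square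
integrable on bounded time intervals. -/
structure Control (hW : IsBrownianReal W P) (Θ : Set ℝ) where
  toFun : ℝ≥0 → Ω → ℝ
  mem : ∀ t ω, toFun t ω ∈ Θ
  progressive : IsProgressive (brownianFiltration hW) toFun
  sq_integrable : ∀ T : ℝ≥0, ∫⁻ ω, (∫⁻ s in Set.Icc 0 (T : ℝ), ‖toFun s.toNNReal ω‖ₑ ^ 2) ∂P < ∞

/-- A simple process: `∑ᵢ ξᵢ 1_{(tᵢ, tᵢ₊₁]}` with `t₀ ≤ t₁ ≤ … ≤ tₙ` and bounded
`ℱ_{tᵢ}`-measurable `ξᵢ`. -/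
structure SimpleProcess (𝓕 : Filtration ℝ≥0 mΩ) where
  n : ℕ
  time : ℕ → ℝ≥0
  time_mono : Monotone time
  coeff : ℕ → Ω → ℝ
  coeff_measurable : ∀ i, Measurable[𝓕 (time i)] (coeff i)
  coeff_bounded : ∃ C : ℝ, ∀ i ω, |coeff i ω| ≤ C

/-- The value of a simple process at time `s`. -/
def SimpleProcess.value {𝓕 : Filtration ℝ≥0 mΩ} (η : SimpleProcess 𝓕) (s : ℝ≥0) (ω : Ω) : ℝ :=
  ∑ i ∈ Finset.range η.n, (Set.Ioc (η.time i) (η.time (i + 1))).indicator (fun _ => η.coeff i ω) s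

/-- The elementary stochastic integral `∫₀ᵗ η dW` of a simple process. -/
def SimpleProcess.integral {𝓕 : Filtration ℝ≥0 mΩ} (η : SimpleProcess 𝓕) (W : ℝ≥0 → Ω → ℝ)
    (t : ℝ≥0) (ω : Ω) : ℝ :=
  ∑ i ∈ Finset.range η.n,
    η.coeff i ω * (W (min (η.time (i + 1)) t) ω - W (min (η.time i) t) ω)

/-- `Y` is a continuous version of the Itô integral process `t ↦ ∫₀ᵗ θ dW`: it is adapted, and
there are simple processes that converge to `θ` in `L²([0,t] × Ω)` and whose elementary
integrals converge to `Y_t` in `L²(P)`, for every `t`. -/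
def IsItoIntegral (hW : IsBrownianReal W P) (θ : ℝ≥0 → Ω → ℝ) (Y : Ω → PathSpace) : Prop :=
  (∀ t, Measurable[brownianFiltration hW t] fun ω => (Y ω).1 t) ∧
  ∃ η : ℕ → SimpleProcess (brownianFiltration hW), ∀ t : ℝ≥0,
    Tendsto (fun k => ∫⁻ ω, (∫⁻ s in Set.Icc 0 (t : ℝ),
      ‖(η k).value s.toNNReal ω - θ s.toNNReal ω‖ₑ ^ 2) ∂P) atTop (𝓝 0) ∧
    Tendsto (fun k => ∫⁻ ω, ‖(η k).integral W t ω - (Y ω).1 t‖ₑ ^ 2 ∂P) atTop (𝓝 0)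

variable {hW : IsBrownianReal W P} {Θ : Set ℝ}

open Classical in
/-- The controlled process `B^θ = ∫ θ dW`, as a path-valued random variable. The continuous
version of the Itô integral exists for every control (Itô's theorem) and is unique up to
indistinguishability. -/
def Control.path (θ : Control hW Θ) : Ω → PathSpace :=
  if h : ∃ Y : Ω → PathSpace, IsItoIntegral hW θ.toFun Y then h.choose
  else fun _ => ⟨0, rfl⟩

theorem Control.measurable_path (θ : Control hW Θ) (t : ℝ≥0) :
    Measurable fun ω => (θ.path ω).1 t := by
  unfold Control.path
  split_ifs with h
  · exact (h.choose_spec.1 t).mono ((brownianFiltration hW).le t) le_rfl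
  · exact measurable_const

/-- The G-expectation `Ê[f] = sup_θ E_P[f(B^θ)]` of a nonnegative path functional. -/
def gExpectation (hW : IsBrownianReal W P) (Θ : Set ℝ) (f : PathSpace → ℝ≥0∞) : ℝ≥0∞ :=
  ⨆ θ : Control hW Θ, ∫⁻ ω, f (θ.path ω) ∂P

end Controls

section Cylinder

/-- The class `C_{l.Lip}`: locally Lipschitz functions whose local Lipschitz constant has
polynomial growth, `|φ(x) - φ(y)| ≤ C (1 + |x|^m + |y|^m) |x - y|`. -/
def LocLip {n : ℕ} (φ : (Fin n → ℝ) → ℝ) : Prop :=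
  ∃ (C : ℝ) (m : ℕ), 0 ≤ C ∧ ∀ x y, |φ x - φ y| ≤ C * (1 + ‖x‖ ^ m + ‖y‖ ^ m) * ‖x - y‖

theorem LocLip.continuous {n : ℕ} {φ : (Fin n → ℝ) → ℝ} (h : LocLip φ) : Continuous φ := by
  obtain ⟨C, m, -, h⟩ := h
  refine continuous_iff_continuousAt.2 fun x => ?_
  rw [ContinuousAt, tendsto_iff_dist_tendsto_zero]
  have hc : Tendsto (fun y => C * (1 + ‖y‖ ^ m + ‖x‖ ^ m) * ‖y - x‖) (𝓝 x) (𝓝 0) := by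
    have : Continuous fun y : Fin n → ℝ => C * (1 + ‖y‖ ^ m + ‖x‖ ^ m) * ‖y - x‖ := by fun_prop
    simpa using this.tendsto x
  exact squeeze_zero (fun _ => dist_nonneg) (fun y => by rw [Real.dist_eq]; exact h y x) hc

/-- The space `C_T` of cylinder functions `φ(B_{t₁∧T}, …, B_{tₙ∧T})`, where `B` is the
coordinate process on the path space and `φ ∈ C_{l.Lip}(ℝⁿ)`. -/
def Cylinder (T : ℝ≥0) : Submodule ℝ (PathSpace → ℝ) where
  carrier := {ξ | ∃ (n : ℕ) (t : Fin n → ℝ≥0) (φ : (Fin n → ℝ) → ℝ), LocLip φ ∧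
    ξ = fun w => φ fun i => w.1 (min (t i) T)}
  zero_mem' := ⟨0, fun _ => 0, fun _ => 0, ⟨0, 0, le_rfl, fun x y => by simp⟩, rfl⟩
  add_mem' := by
    rintro _ _ ⟨n, t, φ, ⟨C, m, hC, hφ⟩, rfl⟩ ⟨n', t', φ', ⟨C', m', hC', hφ'⟩, rfl⟩
    refine ⟨n + n', Fin.append t t', fun x =>
      φ (fun i => x (Fin.castAdd n' i)) + φ' (fun i => x (Fin.natAdd n i)), ?_, ?_⟩
    · have key : ∀ (a b : ℝ) (k l : ℕ), 0 ≤ a → a ≤ b → k ≤ l → a ^ k ≤ 1 + b ^ l := by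
        intro a b k l ha hab hkl
        rcases le_total b 1 with hb | hb
        · have := pow_le_one₀ (n := k) ha (hab.trans hb)
          have := pow_nonneg (ha.trans hab) l
          linarith
        · have h1 := pow_le_pow_left₀ ha hab k
          have h2 := pow_le_pow_right₀ hb hkl
          linarith
      refine ⟨3 * (C + C'), m + m', by positivity, fun x y => ?_⟩
      have hl : ∀ z : Fin (n + n') → ℝ, ‖fun i => z (Fin.castAdd n' i)‖ ≤ ‖z‖ := fun z =>
        (pi_norm_le_iff_of_nonneg (norm_nonneg _)).2 fun i => norm_le_pi_norm z _
      have hr : ∀ z : Fin (n + n') → ℝ, ‖fun i => z (Fin.natAdd n i)‖ ≤ ‖z‖ := fun z =>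
        (pi_norm_le_iff_of_nonneg (norm_nonneg _)).2 fun i => norm_le_pi_norm z _
      have e1 := hφ (fun i => x (Fin.castAdd n' i)) (fun i => y (Fin.castAdd n' i))
      have e2 := hφ' (fun i => x (Fin.natAdd n i)) (fun i => y (Fin.natAdd n i))
      have a1 := key _ _ m (m + m') (norm_nonneg _) (hl x) (by omega)
      have a2 := key _ _ m (m + m') (norm_nonneg _) (hl y) (by omega)
      have b1 := key _ _ m' (m + m') (norm_nonneg _) (hr x) (by omega)
      have b2 := key _ _ m' (m + m') (norm_nonneg _) (hr y) (by omega)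
      have dl := hl (x - y)
      have dr := hr (x - y)
      set S := 1 + ‖x‖ ^ (m + m') + ‖y‖ ^ (m + m') with hS
      have hx0 : 0 ≤ ‖x‖ ^ (m + m') := by positivity
      have hy0 : 0 ≤ ‖y‖ ^ (m + m') := by positivity
      have f1 : |φ (fun i => x (Fin.castAdd n' i)) - φ (fun i => y (Fin.castAdd n' i))|
          ≤ C * (3 * S) * ‖x - y‖ := by
        refine e1.trans ?_
        gcongr
        · linarith
        · exact dl
      have f2 : |φ' (fun i => x (Fin.natAdd n i)) - φ' (fun i => y (Fin.natAdd n i))|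
          ≤ C' * (3 * S) * ‖x - y‖ := by
        refine e2.trans ?_
        gcongr
        · linarith
        · exact dr
      rw [add_sub_add_comm]
      refine (abs_add_le _ _).trans ((add_le_add f1 f2).trans (le_of_eq ?_))
      ring
    · funext w
      simp
  smul_mem' := by
    rintro c _ ⟨n, t, φ, ⟨C, m, hC, hφ⟩, rfl⟩
    refine ⟨n, t, fun x => c * φ x, ⟨|c| * C, m, by positivity, fun x y => ?_⟩, rfl⟩
    rw [← mul_sub, abs_mul, mul_assoc, mul_assoc, ← mul_assoc C]
    exact mul_le_mul_of_nonneg_left (hφ x y) (abs_nonneg c)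

end Cylinder

section Spaces

variable {Ω : Type u} {mΩ : MeasurableSpace Ω} {P : Measure Ω} [P.IsComplete] {W : ℝ≥0 → Ω → ℝ}

/-- Families `{X^θ}_θ` of (`P`-a.s. classes of) random variables, indexed by the controls. The
values of `Phi` below lie at finite `sup_θ ‖·‖_{L^p(P)}` distance from `0`. -/
def ParamFamily (hW : IsBrownianReal W P) (Θ : Set ℝ) (_p : ℝ) : Type u :=
  Control hW Θ → Ω →ₘ[P] ℝ

/-- The space of cylinder functions, to be equipped with the `L_G^p` seminorm. -/
def CylinderSpace (_hW : IsBrownianReal W P) (_Θ : Set ℝ) (_p : ℝ) (T : ℝ≥0) : Type :=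
  Cylinder T

variable {hW : IsBrownianReal W P} {Θ : Set ℝ} {p : ℝ} {T : ℝ≥0}

instance : AddCommGroup (ParamFamily hW Θ p) :=
  inferInstanceAs (AddCommGroup (Control hW Θ → Ω →ₘ[P] ℝ))

/-- Scalars act on families pointwise: `λ {X^θ} = {λ X^θ}`. -/
instance : Module ℝ (ParamFamily hW Θ p) :=
  inferInstanceAs (Module ℝ (Control hW Θ → Ω →ₘ[P] ℝ))

instance : AddCommGroup (CylinderSpace hW Θ p T) := inferInstanceAs (AddCommGroup (Cylinder T))

instance : Module ℝ (CylinderSpace hW Θ p T) := inferInstanceAs (Module ℝ (Cylinder T))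

/-- The path functional underlying a cylinder function. -/
def CylinderSpace.toFun (ξ : CylinderSpace hW Θ p T) : PathSpace → ℝ := ξ.1

/-- The norm `‖ξ‖_{L_G^p} = Ê[|ξ|^p]^{1/p}`. -/
def CylinderSpace.gNorm (ξ : CylinderSpace hW Θ p T) : ℝ≥0∞ :=
  (gExpectation hW Θ fun w => ‖ξ.toFun w‖ₑ ^ p) ^ (1 / p)

/-- The supremum norm `sup_θ ‖X^θ‖_{L^p(P)}`. -/
def ParamFamily.supNorm (X : ParamFamily hW Θ p) : ℝ≥0∞ :=
  ⨆ θ : Control hW Θ, eLpNorm (X θ) (ENNReal.ofReal p) P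

theorem CylinderSpace.measurable_comp (ξ : CylinderSpace hW Θ p T) (θ : Control hW Θ) :
    Measurable fun ω => ξ.toFun (θ.path ω) := by
  obtain ⟨_, n, t, φ, hφ, rfl⟩ := ξ
  exact hφ.continuous.measurable.comp (measurable_pi_lambda _ fun i => θ.measurable_path _)

/-- `Φ` on cylinder functions: `ξ ↦ {ξ^θ}` with `ξ^θ = ξ(B^θ)`, that is,
`φ(B_{t₁∧T}, …, B_{tₙ∧T})^θ = φ(B^θ_{t₁∧T}, …, B^θ_{tₙ∧T})`. -/
def cylinderPhi (ξ : CylinderSpace hW Θ p T) : ParamFamily hW Θ p := fun θ =>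
  AEEqFun.mk (fun ω => ξ.toFun (θ.path ω)) (ξ.measurable_comp θ).aestronglyMeasurable

theorem cylinderPhi_sub (ξ η : CylinderSpace hW Θ p T) :
    cylinderPhi (ξ - η) = cylinderPhi ξ - cylinderPhi η := rfl

theorem cylinderPhi_smul (c : ℝ) (ξ : CylinderSpace hW Θ p T) :
    cylinderPhi (c • ξ) = c • cylinderPhi ξ := rfl

theorem ParamFamily.supNorm_sub_comm (X Y : ParamFamily hW Θ p) :
    (X - Y).supNorm = (Y - X).supNorm := by
  refine iSup_congr fun θ => ?_
  have h : (Y - X) θ = -(X - Y) θ := (neg_sub (X θ) (Y θ)).symm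
  rw [h, eLpNorm_congr_ae (AEEqFun.coeFn_neg ((X - Y) θ)), eLpNorm_neg]

variable [Fact (1 ≤ p)]

theorem one_le_ofReal : 1 ≤ ENNReal.ofReal p := by
  simpa using ENNReal.ofReal_le_ofReal (Fact.out : 1 ≤ p)

theorem supNorm_cylinderPhi (ξ : CylinderSpace hW Θ p T) :
    (cylinderPhi ξ).supNorm = ξ.gNorm := by
  have hp : 0 < p := zero_lt_one.trans_le Fact.out
  have h := (ENNReal.orderIsoRpow (1 / p) (by positivity)).map_iSup
    (fun θ : Control hW Θ => ∫⁻ ω, ‖ξ.toFun (θ.path ω)‖ₑ ^ p ∂P)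
  simp only [ENNReal.orderIsoRpow_apply] at h
  rw [CylinderSpace.gNorm, gExpectation, h, ParamFamily.supNorm]
  refine iSup_congr fun θ => ?_
  rw [cylinderPhi, eLpNorm_congr_ae (AEEqFun.coeFn_mk _ _),
    eLpNorm_eq_lintegral_rpow_enorm_toReal (by simpa using hp) ENNReal.ofReal_ne_top,
    ENNReal.toReal_ofReal hp.le]

theorem ParamFamily.supNorm_add_le (X Y : ParamFamily hW Θ p) :
    (X + Y).supNorm ≤ X.supNorm + Y.supNorm := by
  refine iSup_le fun θ => ?_
  refine (eLpNorm_congr_ae (AEEqFun.coeFn_add (X θ) (Y θ))).le.trans ?_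
  refine (eLpNorm_add_le (X θ).aestronglyMeasurable (Y θ).aestronglyMeasurable
    one_le_ofReal).trans ?_
  exact add_le_add (le_iSup (fun θ => eLpNorm (X θ) (ENNReal.ofReal p) P) θ)
    (le_iSup (fun θ => eLpNorm (Y θ) (ENNReal.ofReal p) P) θ)

/-- The distance `sup_θ ‖X^θ - Y^θ‖_{L^p(P)}` on families. -/
instance : EMetricSpace (ParamFamily hW Θ p) where
  edist X Y := (X - Y).supNorm
  edist_self X := by
    simp only [sub_self, ParamFamily.supNorm]
    refine ENNReal.iSup_eq_zero.2 fun θ => ?_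
    exact (eLpNorm_congr_ae AEEqFun.coeFn_zero).trans eLpNorm_zero
  edist_comm := ParamFamily.supNorm_sub_comm
  edist_triangle X Y Z := by
    rw [← sub_add_sub_cancel X Y Z]
    exact ParamFamily.supNorm_add_le _ _
  eq_of_edist_eq_zero {X Y} h := by
    have h' := ENNReal.iSup_eq_zero.1 h
    refine funext fun θ => sub_eq_zero.1 (AEEqFun.ext ?_)
    have := (eLpNorm_eq_zero_iff ((X - Y) θ).aestronglyMeasurable
      (zero_lt_one.trans_le (one_le_ofReal (p := p))).ne').1 (h' θ)
    exact this.trans AEEqFun.coeFn_zero.symm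

theorem ParamFamily.edist_def (X Y : ParamFamily hW Θ p) : edist X Y = (X - Y).supNorm := rfl

instance : CompleteSpace (ParamFamily hW Θ p) := by
  refine EMetric.complete_of_convergent_controlled_sequences (fun n => 2⁻¹ ^ n)
    (fun n => ENNReal.pow_pos (by simp) n) fun u hu => ?_
  have hle : ∀ N n m, N ≤ n → N ≤ m → ∀ θ,
      eLpNorm (⇑(u n θ) - ⇑(u m θ)) (ENNReal.ofReal p) P < 2⁻¹ ^ N := by
    intro N n m hn hm θ
    rw [← eLpNorm_congr_ae (AEEqFun.coeFn_sub (u n θ) (u m θ))]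
    exact (le_iSup (fun θ => eLpNorm ((u n - u m) θ) (ENNReal.ofReal p) P) θ).trans_lt
      (hu N n m hn hm)
  have hlim : ∀ θ : Control hW Θ, ∃ f : Ω →ₘ[P] ℝ,
      Tendsto (fun n => eLpNorm (⇑(u n θ) - ⇑f) (ENNReal.ofReal p) P) atTop (𝓝 0) := by
    intro θ
    obtain ⟨g, hg, hgt⟩ := Lp.cauchy_complete_eLpNorm (μ := P) one_le_ofReal
      (f := fun n => ⇑(u n θ) - ⇑(u 0 θ)) (B := fun n => 2⁻¹ ^ n)
      (fun n => ⟨(u n θ).aestronglyMeasurable.sub (u 0 θ).aestronglyMeasurable,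
        (hle 0 n 0 (Nat.zero_le _) le_rfl θ).trans_le (by simp)⟩)
      (by rw [ENNReal.tsum_geometric]; simp)
      (fun N n m hn hm => by
        rw [sub_sub_sub_cancel_right]
        exact hle N n m hn hm θ)
    refine ⟨u 0 θ + AEEqFun.mk g hg.1, ?_⟩
    refine hgt.congr fun n => eLpNorm_congr_ae ?_
    filter_upwards [AEEqFun.coeFn_add (u 0 θ) (AEEqFun.mk g hg.1),
      AEEqFun.coeFn_mk g hg.1] with ω h1 h2
    simp only [Pi.sub_apply, Pi.add_apply, h1, h2]
    ring
  choose f hf using hlim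
  refine ⟨f, ?_⟩
  have hbound : ∀ n, edist (u n) f ≤ 2⁻¹ ^ n := by
    intro n
    refine iSup_le fun θ => ?_
    refine (eLpNorm_congr_ae (AEEqFun.coeFn_sub (u n θ) (f θ))).le.trans ?_
    have ht : Tendsto (fun m => (2⁻¹ : ℝ≥0∞) ^ n +
        eLpNorm (⇑(u m θ) - ⇑(f θ)) (ENNReal.ofReal p) P) atTop (𝓝 (2⁻¹ ^ n + 0)) :=
      tendsto_const_nhds.add (hf θ)
    rw [add_zero] at ht
    refine ge_of_tendsto ht (eventually_atTop.2 ⟨n, fun m hm => ?_⟩)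
    rw [← sub_add_sub_cancel (⇑(u n θ)) (⇑(u m θ)) (⇑(f θ))]
    refine (eLpNorm_add_le ((u n θ).aestronglyMeasurable.sub (u m θ).aestronglyMeasurable)
      ((u m θ).aestronglyMeasurable.sub (f θ).aestronglyMeasurable) one_le_ofReal).trans ?_
    exact add_le_add (hle n n m le_rfl hm θ).le le_rfl
  refine tendsto_iff_edist_tendsto_0.2 (tendsto_of_tendsto_of_tendsto_of_le_of_le
    tendsto_const_nhds (ENNReal.tendsto_pow_atTop_nhds_zero_of_lt_one ?_)
    (fun _ => bot_le) hbound)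
  simp

/-- The (pseudo)distance `‖ξ - η‖_{L_G^p}` on cylinder functions. -/
instance : PseudoEMetricSpace (CylinderSpace hW Θ p T) where
  edist ξ η := (ξ - η).gNorm
  edist_self ξ := by
    rw [← supNorm_cylinderPhi, cylinderPhi_sub]
    exact edist_self (cylinderPhi ξ)
  edist_comm ξ η := by
    rw [← supNorm_cylinderPhi, ← supNorm_cylinderPhi, cylinderPhi_sub, cylinderPhi_sub]
    exact edist_comm (cylinderPhi ξ) (cylinderPhi η)
  edist_triangle ξ η ζ := by
    simp only [← supNorm_cylinderPhi, cylinderPhi_sub]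
    exact edist_triangle (cylinderPhi ξ) (cylinderPhi η) (cylinderPhi ζ)

theorem CylinderSpace.edist_def (ξ η : CylinderSpace hW Θ p T) : edist ξ η = (ξ - η).gNorm := rfl

theorem isometry_cylinderPhi :
    Isometry (cylinderPhi : CylinderSpace hW Θ p T → ParamFamily hW Θ p) := fun ξ η => by
  rw [CylinderSpace.edist_def, ← supNorm_cylinderPhi, cylinderPhi_sub, ParamFamily.edist_def]

instance : UniformContinuousConstSMul ℝ (CylinderSpace hW Θ p T) where
  uniformContinuous_const_smul c := by
    refine LipschitzWith.uniformContinuous (K := ‖c‖₊) fun ξ η => ?_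
    rw [CylinderSpace.edist_def, CylinderSpace.edist_def, ← smul_sub, ← supNorm_cylinderPhi,
      ← supNorm_cylinderPhi, cylinderPhi_smul]
    refine iSup_le fun θ => ?_
    refine (eLpNorm_congr_ae (AEEqFun.coeFn_smul c (cylinderPhi (ξ - η) θ))).le.trans ?_
    rw [eLpNorm_const_smul]
    exact mul_le_mul_right (le_iSup
      (fun θ => eLpNorm (cylinderPhi (ξ - η) θ) (ENNReal.ofReal p) P) θ) _

instance : IsUniformAddGroup (CylinderSpace hW Θ p T) where
  uniformContinuous_sub := by
    refine LipschitzWith.uniformContinuous (K := 2) ?_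
    rintro ⟨ξ, η⟩ ⟨ξ', η'⟩
    simp only [CylinderSpace.edist_def, Prod.edist_eq]
    have h : (ξ - η) - (ξ' - η') = (ξ - ξ') - (η - η') := by abel
    rw [h, ← supNorm_cylinderPhi, ← supNorm_cylinderPhi, ← supNorm_cylinderPhi,
      cylinderPhi_sub, ← ParamFamily.edist_def]
    refine (edist_triangle _ 0 _).trans ?_
    rw [edist_comm 0, ParamFamily.edist_def, ParamFamily.edist_def, sub_zero, sub_zero,
      ENNReal.coe_ofNat, two_mul]
    exact add_le_add (le_max_left _ _) (le_max_right _ _)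

/-- The space `L_G^p(Ω_T)`: the completion of the cylinder functions under `‖·‖_{L_G^p}`. -/
abbrev LG (hW : IsBrownianReal W P) (Θ : Set ℝ) (p : ℝ) [Fact (1 ≤ p)] (T : ℝ≥0) : Type :=
  UniformSpace.Completion (CylinderSpace hW Θ p T)

/-- The map `Φ`: the extension by continuity of `cylinderPhi` to `L_G^p(Ω_T)`. -/
def Phi : LG hW Θ p T → ParamFamily hW Θ p :=
  UniformSpace.Completion.extension cylinderPhi

end Spaces

end GExpectation

end

namespace GExpectation

section Scalars

universe v

variable {Ω : Type v} {mΩ : MeasurableSpace Ω} {P : Measure Ω} [P.IsComplete] {W : ℝ≥0 → Ω → ℝ}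
  {hW : IsBrownianReal W P} {Θ : Set ℝ} {p : ℝ} {T : ℝ≥0}

/-! The identity is a density argument. On a cylinder function it is immediate: `ξ ↦ ξ(B^θ)` is
composition with a fixed path-valued map, hence linear in `ξ` for every control. Cylinder functions
are dense in their completion, and for a fixed scalar both `X ↦ Φ(λX)` and `X ↦ λΦ(X)` are
continuous, so agreement on the dense set propagates. Neither Brownian motion nor the Itô integral
enters beyond the definition of `ξ^θ`. The one estimate needed is that multiplication by a constant
is Lipschitz for the supremum norm on families; it follows from homogeneity of each `L^p` norm. -/

theorem ParamFamily.supNorm_smul_le (c : ℝ) (X : ParamFamily hW Θ p) :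
    (c • X).supNorm ≤ ‖c‖ₑ * X.supNorm := by
  refine iSup_le fun θ => ?_
  refine (eLpNorm_congr_ae (AEEqFun.coeFn_smul c (X θ))).le.trans ?_
  -- The factor `‖c‖ₑ` does not depend on `θ`, so bounding each control separately suffices for the
  -- supremum.
  rw [eLpNorm_const_smul]
  exact mul_le_mul_right (le_iSup (fun θ => eLpNorm (X θ) (ENNReal.ofReal p) P) θ) _

variable [Fact (1 ≤ p)]

/-- By linearity the difference of two multiples is the multiple of the difference, so the norm
bound is a Lipschitz bound with constant `|c|`. The scalar stays fixed: families may have infinite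
norm, and for such an `X` the map `c ↦ cX` is not continuous. -/
instance : ContinuousConstSMul ℝ (ParamFamily hW Θ p) where
  continuous_const_smul c := by
    refine LipschitzWith.continuous (K := ‖c‖₊) fun X Y => ?_
    rw [ParamFamily.edist_def, ParamFamily.edist_def, ← smul_sub]
    exact ParamFamily.supNorm_smul_le c (X - Y)

/-- Rests on completeness of the space of families. -/
theorem continuous_Phi : Continuous (Phi : LG hW Θ p T → ParamFamily hW Θ p) :=
  UniformSpace.Completion.continuous_extension

/-- The extension restricts to the original map because `cylinderPhi` is an isometry, hence
uniformly continuous, and limits of families are unique. -/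
theorem Phi_coe (ξ : CylinderSpace hW Θ p T) : Phi (ξ : LG hW Θ p T) = cylinderPhi ξ :=
  UniformSpace.Completion.extension_coe isometry_cylinderPhi.uniformContinuous ξ

end Scalars

end GExpectation

theorem mainTheorem3 {Ω : Type*} [MeasurableSpace Ω] {P : Measure Ω} [P.IsComplete]
    {W : ℝ≥0 → Ω → ℝ} (hW : IsBrownianReal W P)
    (Θ : Set ℝ) (hΘ_compact : IsCompact Θ) (hΘ_convex : Convex ℝ Θ)
    (T : ℝ≥0) (p : ℝ) [Fact (1 ≤ p)]
    (X : GExpectation.LG hW Θ p T) (lam : ℝ) :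
    GExpectation.Phi (lam • X) = lam • GExpectation.Phi X := by
  induction X using UniformSpace.Completion.induction_on with
  | hp =>
    -- The equality set is closed since families are taken modulo a.s. equality, which makes their
    -- space Hausdorff.
    exact isClosed_eq (GExpectation.continuous_Phi.comp (continuous_const_smul lam))
      (GExpectation.continuous_Phi.const_smul lam)
  | ih ξ =>
    -- The scalar action on the completion extends the one on cylinder functions, so `lam • ξ` is
    -- again a cylinder function.
    rw [← UniformSpace.Completion.coe_smul, GExpectation.Phi_coe, GExpectation.Phi_coe,
      GExpectation.cylinderPhi_smul]
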